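/- For $\epsilon,\epsilon'\in\mathbb{R}$, $\zeta\in\mathbb{C}$ and $\tau$ in the upper half plane $\mathbb{H}^2$, let $$\theta\left[\begin{array}{c}\epsilon\\ \epsilon'\end{array}\right](\zeta,\tau)=\sum_{n\in\mathbb{Z}}\exp\left(2\pi i\left[\frac12\left(n+\frac{\epsilon}{2}\right)^2\tau+\left(n+\frac{\epsilon}{2}\right)\left(\zeta+\frac{\epsilon'}{2}\right)\right]\right),$$ and let $\theta'\left[\begin{array}{c}\epsilon\\ \epsilon'\end{array}\right](0,\tau)$ denote its derivative with respect to $\zeta$ at $\zeta=0$. Then for every $\tau\in\mathbb{H}^2$ the values $\theta\left[\begin{array}{c}1\\ 1/4\end{array}\right](0,\tau)$ and $\theta\left[\begin{array}{c}1\\ 3/4\end{array}\right](0,\tau)$ are nonzero, and $$\frac{\theta'\left[\begin{array}{c}1\\ 1/4\end{array}\right](0,\tau)}{\theta\left[\begin{array}{c}1\\ 1/4\end{array}\right](0,\tau)}-\frac{\theta'\left[\begin{array}{c}1\\ 3/4\end{array}\right](0,\tau)}{\theta\left[\begin{array}{c}1\\ 3/4\end{array}\right](0,\tau)}=2\pi\,\theta^2\left[\begin{array}{c}0\\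 0\end{array}\right](0,4\tau),$$ $$\frac{\theta'\left[\begin{array}{c}1\\ 1/4\end{array}\right](0,\tau)}{\theta\left[\begin{array}{c}1\\ 1/4\end{array}\right](0,\tau)}+\frac{\theta'\left[\begin{array}{c}1\\ 3/4\end{array}\right](0,\tau)}{\theta\left[\begin{array}{c}1\\ 3/4\end{array}\right](0,\tau)}=-2\sqrt{2}\,\pi\,\theta\left[\begin{array}{c}0\\ 0\end{array}\right](0,2\tau)\,\theta\left[\begin{array}{c}0\\ 0\end{array}\right](0,4\tau).$$ -/

import Mathlib

/-- The theta function with real characteristics `ε`, `ε'`: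
`∑ n ∈ ℤ, exp (2πi (½ (n + ε/2)² τ + (n + ε/2) (ζ + ε'/2)))`, for `ζ ∈ ℂ` and `Im τ > 0`. -/
noncomputable def thetaChar (ε ε' : ℝ) (ζ τ : ℂ) : ℂ :=
  ∑' n : ℤ, Complex.exp (2 * (Real.pi : ℂ) * Complex.I *
    (1 / 2 * ((n : ℂ) + (ε : ℂ) / 2) ^ 2 * τ +
      ((n : ℂ) + (ε : ℂ) / 2) * (ζ + (ε' : ℂ) / 2)))

/-- The derivative of the theta function with characteristics in the variable `ζ`. -/
noncomputable def thetaCharDeriv (ε ε' : ℝ) (ζ τ : ℂ) : ℂ :=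
  deriv (fun w : ℂ => thetaChar ε ε' w τ) ζ

/-- A summand of `thetaChar` is an exponential factor times a summand of `jacobiTheta₂`. -/
theorem thetaChar_term_eq (ε ε' : ℝ) (ζ τ : ℂ) (n : ℤ) :
    Complex.exp (2 * (Real.pi : ℂ) * Complex.I *
      (1 / 2 * ((n : ℂ) + (ε : ℂ) / 2) ^ 2 * τ +
        ((n : ℂ) + (ε : ℂ) / 2) * (ζ + (ε' : ℂ) / 2))) =
    Complex.exp ((Real.pi : ℂ) * Complex.I * ((ε : ℂ) ^ 2 / 4 * τ + ε * (ζ + (ε' : ℂ) / 2))) *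
      jacobiTheta₂_term n (ζ + (ε' : ℂ) / 2 + (ε : ℂ) / 2 * τ) τ := by
  rw [jacobiTheta₂_term, ← Complex.exp_add]
  congr 1
  ring

/-- The series defining `thetaChar` converges on the upper half plane. -/
theorem summable_thetaChar (ε ε' : ℝ) (ζ : ℂ) {τ : ℂ} (hτ : 0 < τ.im) :
    Summable fun n : ℤ => Complex.exp (2 * (Real.pi : ℂ) * Complex.I *
      (1 / 2 * ((n : ℂ) + (ε : ℂ) / 2) ^ 2 * τ +
        ((n : ℂ) + (ε : ℂ) / 2) * (ζ + (ε' : ℂ) / 2))) := by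
  simp only [thetaChar_term_eq]
  exact ((summable_jacobiTheta₂_term_iff _ τ).2 hτ).mul_left _

/-- `thetaChar` is entire in `ζ`, so that `thetaCharDeriv` is a genuine derivative. -/
theorem differentiable_thetaChar (ε ε' : ℝ) {τ : ℂ} (hτ : 0 < τ.im) :
    Differentiable ℂ fun w : ℂ => thetaChar ε ε' w τ := by
  have h : (fun w : ℂ => thetaChar ε ε' w τ) = fun w : ℂ =>
      Complex.exp ((Real.pi : ℂ) * Complex.I * ((ε : ℂ) ^ 2 / 4 * τ + ε * (w + (ε' : ℂ) / 2))) *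
        jacobiTheta₂ (w + (ε' : ℂ) / 2 + (ε : ℂ) / 2 * τ) τ := by
    funext w
    simp only [thetaChar, thetaChar_term_eq, tsum_mul_left, jacobiTheta₂]
  rw [h]
  intro w
  refine DifferentiableAt.mul (by fun_prop) ?_
  exact (differentiableAt_jacobiTheta₂_fst _ hτ).comp w
    (f := fun w : ℂ => w + (ε' : ℂ) / 2 + (ε : ℂ) / 2 * τ) (by fun_prop)

/-! Write θ₀, θ₁ for first characteristic 0, 1 with second characteristic 0. The second
characteristic translates ζ, so the claim concerns θ₁ at 1/8 and 3/8. Duplication formulas turn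
products at τ into sums of products at 2τ. Since 1/8 + 3/8 = 1/2, and θ₁ and θ₀' vanish at 1/2, only
one product survives in the common denominator and in each numerator
(`thetaChar_one_one_eighth_mul`, `thetaCharDeriv_one_eighth_sub`, `thetaCharDeriv_one_eighth_add`).

What remains is Jacobi's derivative formula `thetaCharDeriv_one_one_half` and the √2 identity
`thetaChar_one_zero_mul_zero_one_fourth`. In both, a quotient of theta values is invariant under τ ↦
2τ by duplication, hence equals its limit along 2^k τ, read off from the leading terms. Nonvanishing
is similar: a zero would propagate along 2^k τ and contradict the limit. -/

/-! ### Symmetries and special values -/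

/-- The theta function with characteristics is a modulated two-variable Jacobi theta function. -/
theorem thetaChar_eq_jacobiTheta₂ (ε ε' : ℝ) (ζ τ : ℂ) :
    thetaChar ε ε' ζ τ =
      Complex.exp ((Real.pi : ℂ) * Complex.I * ((ε : ℂ) ^ 2 / 4 * τ + ε * (ζ + (ε' : ℂ) / 2))) *
        jacobiTheta₂ (ζ + (ε' : ℂ) / 2 + (ε : ℂ) / 2 * τ) τ := by
  simp only [thetaChar, thetaChar_term_eq, tsum_mul_left, jacobiTheta₂]

/-- The second characteristic is a translation of the variable. -/
theorem thetaChar_snd_eq (ε ε' : ℝ) (ζ τ : ℂ) :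
    thetaChar ε ε' ζ τ = thetaChar ε 0 (ζ + (ε' : ℂ) / 2) τ := by
  simp [thetaChar]

theorem thetaCharDeriv_snd_eq (ε ε' : ℝ) (ζ τ : ℂ) :
    thetaCharDeriv ε ε' ζ τ = thetaCharDeriv ε 0 (ζ + (ε' : ℂ) / 2) τ := by
  simp only [thetaCharDeriv, thetaChar_snd_eq ε ε']
  exact deriv_comp_add_const (fun w => thetaChar ε 0 w τ) _ _

theorem hasDerivAt_thetaChar (ε ε' : ℝ) (ζ : ℂ) {τ : ℂ} (hτ : 0 < τ.im) :
    HasDerivAt (fun w => thetaChar ε ε' w τ) (thetaCharDeriv ε ε' ζ τ) ζ :=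
  (differentiable_thetaChar ε ε' hτ ζ).hasDerivAt

theorem thetaChar_fst_add_two (ε ε' : ℝ) (ζ τ : ℂ) :
    thetaChar (ε + 2) ε' ζ τ = thetaChar ε ε' ζ τ := by
  simp only [thetaChar]
  rw [← (Equiv.subRight (1 : ℤ)).tsum_eq]
  refine tsum_congr fun n => ?_
  congr 1
  simp
  ring

theorem thetaChar_zero_neg (ζ τ : ℂ) : thetaChar 0 0 (-ζ) τ = thetaChar 0 0 ζ τ := by
  simp only [thetaChar]
  rw [← (Equiv.neg ℤ).tsum_eq]
  refine tsum_congr fun n => ?_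
  congr 2
  simp

theorem thetaChar_one_neg (ζ τ : ℂ) : thetaChar 1 0 (-ζ) τ = thetaChar 1 0 ζ τ := by
  simp only [thetaChar]
  -- The reindexing n ↦ -1 - n negates n + 1/2.
  rw [← (Equiv.subLeft (-1 : ℤ)).tsum_eq]
  refine tsum_congr fun n => ?_
  congr 2
  simp
  ring

/-- Translating ζ by 1 multiplies each term by exp(2πi(n + 1/2)) = -1, while θ₁ is even. -/
theorem thetaChar_one_one_half (τ : ℂ) : thetaChar 1 0 (1 / 2) τ = 0 := by
  have h : thetaChar 1 0 (1 / 2) τ = -thetaChar 1 0 (-(1 / 2)) τ := by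
    simp only [thetaChar]
    rw [← tsum_neg]
    refine tsum_congr fun n => ?_
    rw [← mul_neg_one, ← Complex.exp_pi_mul_I, ← Complex.exp_add,
      Complex.exp_eq_exp_iff_exists_int]
    refine ⟨n, ?_⟩
    push_cast
    ring
  rw [thetaChar_one_neg] at h
  exact self_eq_neg.mp h

theorem thetaCharDeriv_zero_neg (ζ τ : ℂ) :
    thetaCharDeriv 0 0 (-ζ) τ = -thetaCharDeriv 0 0 ζ τ := by
  have h := deriv_comp_neg (fun w => thetaChar 0 0 w τ) ζ
  simp only [thetaChar_zero_neg] at h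
  simp only [thetaCharDeriv, h, neg_neg]

theorem thetaCharDeriv_one_neg (ζ τ : ℂ) :
    thetaCharDeriv 1 0 (-ζ) τ = -thetaCharDeriv 1 0 ζ τ := by
  have h := deriv_comp_neg (fun w => thetaChar 1 0 w τ) ζ
  simp only [thetaChar_one_neg] at h
  simp only [thetaCharDeriv, h, neg_neg]

theorem thetaChar_zero_add_one (ζ τ : ℂ) : thetaChar 0 0 (ζ + 1) τ = thetaChar 0 0 ζ τ := by
  simp [thetaChar_eq_jacobiTheta₂, jacobiTheta₂_add_left]

theorem thetaCharDeriv_zero_add_one (ζ τ : ℂ) :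
    thetaCharDeriv 0 0 (ζ + 1) τ = thetaCharDeriv 0 0 ζ τ := by
  have h := deriv_comp_add_const (fun w => thetaChar 0 0 w τ) 1 ζ
  simp only [thetaChar_zero_add_one] at h
  exact h.symm

/-- The derivative is odd and 1-periodic, and 1/2 = -1/2 + 1. -/
theorem thetaCharDeriv_zero_one_half (τ : ℂ) : thetaCharDeriv 0 0 (1 / 2) τ = 0 := by
  have h := thetaCharDeriv_zero_add_one (-(1 / 2)) τ
  rw [thetaCharDeriv_zero_neg, show -(1 / 2 : ℂ) + 1 = 1 / 2 by norm_num] at h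
  exact self_eq_neg.mp h

/-! ### Duplication formulas -/

/-- Pairs of integers are of the form `(j + k, j - k)` or `(j + k + 1, j - k)`. -/
noncomputable def intPairParityEquiv : (ℤ × ℤ) ⊕ (ℤ × ℤ) ≃ ℤ × ℤ :=
  Equiv.ofBijective
    (Sum.elim (fun p => (p.1 + p.2, p.1 - p.2)) (fun p => (p.1 + p.2 + 1, p.1 - p.2))) <| by
    constructor
    · rintro (⟨a, b⟩ | ⟨a, b⟩) (⟨c, d⟩ | ⟨c, d⟩) h <;>
        simp only [Sum.elim_inl, Sum.elim_inr, Prod.mk.injEq, Sum.inl.injEq, Sum.inr.injEq,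
          reduceCtorEq] at h ⊢ <;> omega
    · rintro ⟨n, m⟩
      rcases Int.even_or_odd' (n + m) with ⟨k, hk | hk⟩
      · exact ⟨Sum.inl (k, n - k), by simp; omega⟩
      · exact ⟨Sum.inr (k, n - k - 1), by simp; omega⟩

theorem intPairParityEquiv_inl (p : ℤ × ℤ) :
    intPairParityEquiv (Sum.inl p) = (p.1 + p.2, p.1 - p.2) := rfl

theorem intPairParityEquiv_inr (p : ℤ × ℤ) :
    intPairParityEquiv (Sum.inr p) = (p.1 + p.2 + 1, p.1 - p.2) := rfl

/-- The summand of the theta series with second characteristic zero. -/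
noncomputable def thetaTerm (ε : ℝ) (n : ℤ) (ζ τ : ℂ) : ℂ :=
  Complex.exp ((Real.pi : ℂ) * Complex.I *
    (((n : ℂ) + (ε : ℂ) / 2) ^ 2 * τ + 2 * ((n : ℂ) + (ε : ℂ) / 2) * ζ))

theorem hasSum_thetaTerm (ε : ℝ) (ζ : ℂ) {τ : ℂ} (hτ : 0 < τ.im) :
    HasSum (fun n => thetaTerm ε n ζ τ) (thetaChar ε 0 ζ τ) := by
  have h := (summable_thetaChar ε 0 ζ hτ).hasSum
  rw [← thetaChar] at h
  refine h.congr_fun fun n => ?_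
  rw [thetaTerm]
  congr 1
  push_cast
  ring

theorem HasSum.mul_prod {ι κ : Type*} {f : ι → ℂ} {g : κ → ℂ} {a b : ℂ} (hf : HasSum f a)
    (hg : HasSum g b) : HasSum (fun p : ι × κ => f p.1 * g p.2) (a * b) :=
  hf.mul hg (summable_mul_of_summable_norm hf.summable.norm hg.summable.norm)

theorem hasSum_thetaTerm_mul (ε δ : ℝ) (x y : ℂ) {τ : ℂ} (hτ : 0 < τ.im) :
    HasSum (fun p : ℤ × ℤ => thetaTerm ε p.1 x τ * thetaTerm δ p.2 y τ)
      (thetaChar ε 0 x τ * thetaChar δ 0 y τ) := by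
  have h := (hasSum_thetaTerm ε x hτ).mul_prod (hasSum_thetaTerm δ y hτ)
  exact h

theorem two_mul_im_pos {τ : ℂ} (hτ : 0 < τ.im) : 0 < (2 * τ).im := by
  simpa using hτ

/-- The duplication formula for products of theta functions with characteristics. -/
theorem thetaChar_mul_thetaChar (ε δ : ℝ) (u v : ℂ) {τ : ℂ} (hτ : 0 < τ.im) :
    thetaChar ε 0 u τ * thetaChar δ 0 v τ =
      thetaChar ((ε + δ) / 2) 0 (u + v) (2 * τ) * thetaChar ((ε - δ) / 2) 0 (u - v) (2 * τ) +
      thetaChar ((ε + δ) / 2 + 1) 0 (u + v) (2 * τ) *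
        thetaChar ((ε - δ) / 2 + 1) 0 (u - v) (2 * τ) := by
  have h2 := two_mul_im_pos hτ
  -- With a = (ε + δ)/4 and b = (ε - δ)/4, pairs of equal parity have n + ε/2 = (j + a) + (k + b)
  -- and m + δ/2 = (j + a) - (k + b), so the squares add up to 2(j + a)² + 2(k + b)². Opposite
  -- parity shifts j and k by 1/2, that is, both characteristics by 1.
  refine (intPairParityEquiv.hasSum_iff.mpr (hasSum_thetaTerm_mul ε δ u v hτ)).unique
    (HasSum.sum ?_ ?_)
  · refine HasSum.congr_fun (hasSum_thetaTerm_mul ((ε + δ) / 2) ((ε - δ) / 2) (u + v) (u - v)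
      h2) fun p => ?_
    simp only [Function.comp, intPairParityEquiv_inl, thetaTerm, ← Complex.exp_add]
    congr 1
    push_cast
    ring
  · refine HasSum.congr_fun (hasSum_thetaTerm_mul ((ε + δ) / 2 + 1) ((ε - δ) / 2 + 1) (u + v) (u - v)
      h2) fun p => ?_
    simp only [Function.comp, intPairParityEquiv_inr, thetaTerm, ← Complex.exp_add]
    congr 1
    push_cast
    ring

theorem thetaChar_zero_mul_zero (u v : ℂ) {τ : ℂ} (hτ : 0 < τ.im) :
    thetaChar 0 0 u τ * thetaChar 0 0 v τ =
      thetaChar 0 0 (u + v) (2 * τ) * thetaChar 0 0 (u - v) (2 * τ) +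
      thetaChar 1 0 (u + v) (2 * τ) * thetaChar 1 0 (u - v) (2 * τ) := by
  simpa using thetaChar_mul_thetaChar 0 0 u v hτ

theorem thetaChar_one_mul_one (u v : ℂ) {τ : ℂ} (hτ : 0 < τ.im) :
    thetaChar 1 0 u τ * thetaChar 1 0 v τ =
      thetaChar 1 0 (u + v) (2 * τ) * thetaChar 0 0 (u - v) (2 * τ) +
      thetaChar 0 0 (u + v) (2 * τ) * thetaChar 1 0 (u - v) (2 * τ) := by
  have h := thetaChar_mul_thetaChar 1 1 u v hτ
  have h' := thetaChar_fst_add_two 0 0 (u + v) (2 * τ)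
  norm_num at h h'
  rwa [h'] at h

/-- The derivative of the duplication formula along the diagonal. -/
theorem thetaCharDeriv_one_mul_add (u v : ℂ) {τ : ℂ} (hτ : 0 < τ.im) :
    thetaCharDeriv 1 0 u τ * thetaChar 1 0 v τ + thetaChar 1 0 u τ * thetaCharDeriv 1 0 v τ =
      2 * (thetaCharDeriv 1 0 (u + v) (2 * τ) * thetaChar 0 0 (u - v) (2 * τ) +
      thetaCharDeriv 0 0 (u + v) (2 * τ) * thetaChar 1 0 (u - v) (2 * τ)) := by
  have h2 := two_mul_im_pos hτ
  have hl (w : ℂ) : HasDerivAt (fun z => thetaChar 1 0 (w + z) τ) (thetaCharDeriv 1 0 w τ) 0 :=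
    HasDerivAt.comp_const_add w 0 (by simpa using hasDerivAt_thetaChar 1 0 (w + 0) hτ)
  -- Moving u and v together by z fixes u - v, so only the factors at u + v + 2z are differentiated;
  -- hence the 2.
  have hr (ε : ℝ) : HasDerivAt (fun z => thetaChar ε 0 (u + v + 2 * z) (2 * τ))
      (thetaCharDeriv ε 0 (u + v) (2 * τ) * 2) 0 := by
    have shift : HasDerivAt (fun z : ℂ => u + v + 2 * z) 2 0 := by
      simpa using ((hasDerivAt_id (0 : ℂ)).const_mul 2).const_add (u + v)
    have h := hasDerivAt_thetaChar ε 0 (u + v + 2 * 0) h2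
    have h' := h.comp (0 : ℂ) shift
    rwa [mul_zero, add_zero] at h'
  have hL := (hl u).mul (hl v)
  have hR := ((hr 1).mul_const (thetaChar 0 0 (u - v) (2 * τ))).add
    ((hr 0).mul_const (thetaChar 1 0 (u - v) (2 * τ)))
  have e : ((fun z => thetaChar 1 0 (u + z) τ) * fun z => thetaChar 1 0 (v + z) τ) =
      ((fun z => thetaChar 1 0 (u + v + 2 * z) (2 * τ) * thetaChar 0 0 (u - v) (2 * τ)) +
      fun z => thetaChar 0 0 (u + v + 2 * z) (2 * τ) * thetaChar 1 0 (u - v) (2 * τ)) := by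
    funext z
    simp only [Pi.mul_apply, Pi.add_apply]
    rw [thetaChar_one_mul_one _ _ hτ, show u + z + (v + z) = u + v + 2 * z by ring,
      show u + z - (v + z) = u - v by ring]
  rw [e] at hL
  have h := hL.unique hR
  simp only [add_zero] at h
  linear_combination h

noncomputable def intParityEquiv : ℤ ⊕ ℤ ≃ ℤ :=
  Equiv.ofBijective (Sum.elim (fun n => 2 * n) (fun n => 2 * n + 1)) <| by
    constructor
    · rintro (a | a) (c | c) h <;>
        simp only [Sum.elim_inl, Sum.elim_inr, Sum.inl.injEq, Sum.inr.injEq, reduceCtorEq]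
          at h ⊢ <;> omega
    · intro n
      rcases Int.even_or_odd' n with ⟨k, hk | hk⟩
      · exact ⟨Sum.inl k, hk.symm⟩
      · exact ⟨Sum.inr k, hk.symm⟩

theorem intParityEquiv_inl (n : ℤ) : intParityEquiv (Sum.inl n) = 2 * n := rfl

theorem intParityEquiv_inr (n : ℤ) : intParityEquiv (Sum.inr n) = 2 * n + 1 := rfl

/-- Splitting the theta series into its even and odd parts. -/
theorem thetaChar_zero_eq_add (ζ : ℂ) {τ : ℂ} (hτ : 0 < τ.im) :
    thetaChar 0 0 ζ τ =
      thetaChar 0 0 (2 * ζ) (2 * (2 * τ)) + thetaChar 1 0 (2 * ζ) (2 * (2 * τ)) := by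
  have h4 := two_mul_im_pos (two_mul_im_pos hτ)
  refine (intParityEquiv.hasSum_iff.mpr (hasSum_thetaTerm 0 ζ hτ)).unique (HasSum.sum ?_ ?_)
  · refine HasSum.congr_fun (hasSum_thetaTerm 0 (2 * ζ) h4) fun n => ?_
    simp only [Function.comp, intParityEquiv_inl, thetaTerm]
    congr 1
    push_cast
    ring
  · refine HasSum.congr_fun (hasSum_thetaTerm 1 (2 * ζ) h4) fun n => ?_
    simp only [Function.comp, intParityEquiv_inr, thetaTerm]
    congr 1
    push_cast
    ring

theorem thetaChar_zero_one_fourth {τ : ℂ} (hτ : 0 < τ.im) :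
    thetaChar 0 0 (1 / 4) τ = thetaChar 0 0 (1 / 2) (2 * (2 * τ)) := by
  rw [thetaChar_zero_eq_add _ hτ, show (2 : ℂ) * (1 / 4) = 1 / 2 by norm_num,
    thetaChar_one_one_half, add_zero]

/-! ### Limits along 2^k τ -/

open Filter Topology

/-- Doubling τ squares each q n. The k = 0 series dominates, and only the terms with q n = 1
survive. -/
theorem tendsto_tsum_mul_pow_two_pow {c q : ℤ → ℂ} (hs : Summable fun n => c n * q n)
    (s : Finset ℤ) (h1 : ∀ n ∈ s, q n = 1) (h2 : ∀ n ∉ s, ‖q n‖ < 1) :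
    Tendsto (fun k : ℕ => ∑' n, c n * q n ^ 2 ^ k) atTop (𝓝 (∑ n ∈ s, c n)) := by
  have hlim : ∑ n ∈ s, c n = ∑' n, if n ∈ s then c n else 0 := by
    rw [tsum_eq_sum (s := s) fun n hn => if_neg hn]
    exact Finset.sum_congr rfl fun n hn => (if_pos hn).symm
  rw [hlim]
  refine tendsto_tsum_of_dominated_convergence hs.norm (fun n => ?_)
    (Eventually.of_forall fun k n => ?_)
  · by_cases hn : n ∈ s
    · simp [hn, h1 n hn]
    · have h := (tendsto_pow_atTop_nhds_zero_of_norm_lt_one (h2 n hn)).comp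
        (tendsto_pow_atTop_atTop_of_one_lt (one_lt_two : (1 : ℕ) < 2))
      simpa [hn] using h.const_mul (c n)
  · have hq : ‖q n‖ ≤ 1 := by
      by_cases hn : n ∈ s
      · simp [h1 n hn]
      · exact (h2 n hn).le
    rw [norm_mul, norm_mul, norm_pow]
    exact mul_le_mul_of_nonneg_left
      (pow_le_of_le_one (norm_nonneg _) hq (by positivity)) (norm_nonneg _)

theorem norm_exp_pi_mul_I_lt_one {a : ℝ} (ha : 0 < a) {τ : ℂ} (hτ : 0 < τ.im) :
    ‖Complex.exp ((Real.pi : ℂ) * Complex.I * a * τ)‖ < 1 := by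
  rw [Complex.norm_exp, Real.exp_lt_one_iff]
  have : ((Real.pi : ℂ) * Complex.I * a * τ).re = -(Real.pi * a * τ.im) := by
    simp [Complex.mul_re, Complex.mul_im]
  rw [this]
  have := Real.pi_pos
  simp only [Left.neg_neg_iff]
  positivity

theorem two_pow_mul_im_pos {τ : ℂ} (hτ : 0 < τ.im) (k : ℕ) : 0 < (2 ^ k * τ).im := by
  induction k with
  | zero => simpa using hτ
  | succ k ih => rw [pow_succ', mul_assoc]; exact two_mul_im_pos ih

theorem tendsto_thetaChar_zero (ζ : ℂ) {τ : ℂ} (hτ : 0 < τ.im) :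
    Tendsto (fun k : ℕ => thetaChar 0 0 ζ (2 ^ k * τ)) atTop (𝓝 1) := by
  have key (n : ℤ) (k : ℕ) : thetaTerm 0 n ζ (2 ^ k * τ) =
      Complex.exp (2 * Real.pi * Complex.I * n * ζ) *
        Complex.exp ((Real.pi : ℂ) * Complex.I * ((n : ℝ) ^ 2 : ℝ) * τ) ^ 2 ^ k := by
    rw [← Complex.exp_nat_mul, ← Complex.exp_add, thetaTerm]
    congr 1
    push_cast
    ring
  have hs := (hasSum_thetaTerm 0 ζ hτ).summable
  have key0 (n : ℤ) := key n 0
  simp only [pow_zero, one_mul, pow_one] at key0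
  simp only [key0] at hs
  have h := tendsto_tsum_mul_pow_two_pow hs {0} (by simp) fun n hn =>
    norm_exp_pi_mul_I_lt_one
      (sq_pos_of_ne_zero (Int.cast_ne_zero.mpr (Finset.notMem_singleton.mp hn))) hτ
  simp only [← key, (hasSum_thetaTerm 0 ζ (two_pow_mul_im_pos hτ _)).tsum_eq] at h
  simpa using h

/-- Since (n + 1/2)² = n(n + 1) + 1/4, the prefactor leaves the exponent n(n + 1), which is zero
only for n = 0, -1. The weights a cover both the series and its ζ-derivative. -/
theorem tendsto_tsum_thetaTerm_one {a : ℤ → ℂ} (ζ : ℂ) {τ : ℂ} (hτ : 0 < τ.im)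
    (hs : Summable fun n => a n * thetaTerm 1 n ζ τ) :
    Tendsto (fun k : ℕ => Complex.exp (-((Real.pi : ℂ) * Complex.I * (2 ^ k * τ) / 4)) *
      ∑' n, a n * thetaTerm 1 n ζ (2 ^ k * τ)) atTop
      (𝓝 (a 0 * Complex.exp ((Real.pi : ℂ) * Complex.I * ζ) +
        a (-1) * Complex.exp (-((Real.pi : ℂ) * Complex.I * ζ)))) := by
  have key (n : ℤ) (k : ℕ) : Complex.exp (-((Real.pi : ℂ) * Complex.I * (2 ^ k * τ) / 4)) *
      (a n * thetaTerm 1 n ζ (2 ^ k * τ)) =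
      a n * Complex.exp (Real.pi * Complex.I * (2 * n + 1) * ζ) *
        Complex.exp ((Real.pi : ℂ) * Complex.I * ((n : ℝ) * (n + 1) : ℝ) * τ) ^ 2 ^ k := by
    rw [← Complex.exp_nat_mul, thetaTerm, mul_left_comm, ← Complex.exp_add, mul_assoc (a n),
      ← Complex.exp_add]
    congr 2
    push_cast
    ring
  have hs' := hs.mul_left (Complex.exp (-((Real.pi : ℂ) * Complex.I * (2 ^ 0 * τ) / 4)))
  have key0 (n : ℤ) := key n 0
  simp only [pow_zero, one_mul, pow_one] at key0 hs'
  simp only [key0] at hs'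
  have h := tendsto_tsum_mul_pow_two_pow hs' {0, -1} (by simp) fun n hn => by
    refine norm_exp_pi_mul_I_lt_one ?_ hτ
    simp only [Finset.mem_insert, Finset.mem_singleton, not_or] at hn
    have : 0 < n * (n + 1) := by
      rcases lt_or_gt_of_ne hn.1 with h | h
      · exact mul_pos_of_neg_of_neg h (by omega)
      · positivity
    exact_mod_cast this
  simp only [← key, tsum_mul_left] at h
  convert h using 2
  rw [Finset.sum_pair (by norm_num)]
  congr 3 <;> push_cast <;> ring_nf

theorem hasSum_thetaTerm_deriv (ε : ℝ) (ζ : ℂ) {τ : ℂ} (hτ : 0 < τ.im) :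
    HasSum (fun n : ℤ => (Real.pi : ℂ) * Complex.I * (2 * n + ε) * thetaTerm ε n ζ τ)
      (thetaCharDeriv ε 0 ζ τ) := by
  have hP : HasDerivAt (fun w => Complex.exp ((Real.pi : ℂ) * Complex.I *
      ((ε : ℂ) ^ 2 / 4 * τ + ε * w)))
      (Complex.exp ((Real.pi : ℂ) * Complex.I * ((ε : ℂ) ^ 2 / 4 * τ + ε * ζ)) *
        ((Real.pi : ℂ) * Complex.I * ε)) ζ := by
    refine HasDerivAt.cexp ?_
    simpa using (((hasDerivAt_id ζ).const_mul (ε : ℂ)).const_add _).const_mul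
      ((Real.pi : ℂ) * Complex.I)
  have hJ := HasDerivAt.comp_add_const ζ ((ε : ℂ) / 2 * τ)
    (hasDerivAt_jacobiTheta₂_fst (ζ + (ε : ℂ) / 2 * τ) hτ)
  have hd := hP.mul hJ
  have he : thetaCharDeriv ε 0 ζ τ = _ := (hasDerivAt_thetaChar ε 0 ζ hτ).unique
    (hd.congr_of_eventuallyEq (Eventually.of_forall fun w => by
      simp [thetaChar_eq_jacobiTheta₂]))
  rw [he]
  have h1 := (hasSum_jacobiTheta₂_term (ζ + (ε : ℂ) / 2 * τ) hτ).mul_left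
    (Complex.exp ((Real.pi : ℂ) * Complex.I * ((ε : ℂ) ^ 2 / 4 * τ + ε * ζ)) *
        ((Real.pi : ℂ) * Complex.I * ε))
  have h2 := (hasSum_jacobiTheta₂'_term (ζ + (ε : ℂ) / 2 * τ) hτ).mul_left
    (Complex.exp ((Real.pi : ℂ) * Complex.I * ((ε : ℂ) ^ 2 / 4 * τ + ε * ζ)))
  refine HasSum.congr_fun (h1.add h2) fun n => ?_
  have e : thetaTerm ε n ζ τ =
      Complex.exp ((Real.pi : ℂ) * Complex.I * ((ε : ℂ) ^ 2 / 4 * τ + ε * ζ)) *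
        jacobiTheta₂_term n (ζ + (ε : ℂ) / 2 * τ) τ := by
    rw [thetaTerm, jacobiTheta₂_term, ← Complex.exp_add]
    congr 1
    ring
  rw [e, jacobiTheta₂'_term]
  ring

theorem tendsto_thetaChar_one (ζ : ℂ) {τ : ℂ} (hτ : 0 < τ.im) :
    Tendsto (fun k : ℕ => Complex.exp (-((Real.pi : ℂ) * Complex.I * (2 ^ k * τ) / 4)) *
      thetaChar 1 0 ζ (2 ^ k * τ)) atTop (𝓝 (2 * Complex.cos (Real.pi * ζ))) := by
  have h := tendsto_tsum_thetaTerm_one (a := fun _ => 1) ζ hτ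
    (by simpa using (hasSum_thetaTerm 1 ζ hτ).summable)
  simp only [one_mul, (hasSum_thetaTerm 1 ζ (two_pow_mul_im_pos hτ _)).tsum_eq] at h
  convert h using 2
  rw [Complex.cos]
  ring_nf

theorem tendsto_thetaCharDeriv_one (ζ : ℂ) {τ : ℂ} (hτ : 0 < τ.im) :
    Tendsto (fun k : ℕ => Complex.exp (-((Real.pi : ℂ) * Complex.I * (2 ^ k * τ) / 4)) *
      thetaCharDeriv 1 0 ζ (2 ^ k * τ)) atTop
      (𝓝 (-(2 * Real.pi * Complex.sin (Real.pi * ζ)))) := by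
  have h := tendsto_tsum_thetaTerm_one ζ hτ (hasSum_thetaTerm_deriv 1 ζ hτ).summable
  simp only [(hasSum_thetaTerm_deriv 1 ζ (two_pow_mul_im_pos hτ _)).tsum_eq] at h
  convert h using 2
  rw [mul_right_comm, Complex.sin]
  push_cast
  ring_nf

/-- A property stable under `τ ↦ 2τ` holds along the sequence `2 ^ k * τ`. -/
theorem forall_two_pow_mul {P : ℂ → Prop} (hP : ∀ τ : ℂ, 0 < τ.im → P τ → P (2 * τ)) {τ : ℂ}
    (hτ : 0 < τ.im) (h : P τ) (k : ℕ) : P (2 ^ k * τ) := by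
  induction k with
  | zero => simpa using h
  | succ k ih =>
    rw [pow_succ', mul_assoc]
    exact hP _ (two_pow_mul_im_pos hτ k) ih

/-- A function invariant under `τ ↦ 2τ` equals its limit along `2 ^ k * τ`. -/
theorem eq_of_tendsto_two_pow_mul {f : ℂ → ℂ} (hf : ∀ τ : ℂ, 0 < τ.im → f (2 * τ) = f τ) {τ L : ℂ}
    (hτ : 0 < τ.im) (h : Tendsto (fun k : ℕ => f (2 ^ k * τ)) atTop (𝓝 L)) : f τ = L := by
  have hc (k : ℕ) : f (2 ^ k * τ) = f τ :=
    forall_two_pow_mul (P := fun σ => f σ = f τ) (fun σ hσ e => (hf σ hσ).trans e) hτ rfl k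
  simp only [hc] at h
  exact tendsto_nhds_unique tendsto_const_nhds h

/-! ### Duplication at special points and nonvanishing -/

theorem thetaChar_zero_mul_one_half {τ : ℂ} (hτ : 0 < τ.im) :
    thetaChar 0 0 0 τ * thetaChar 0 0 (1 / 2) τ = thetaChar 0 0 (1 / 2) (2 * τ) ^ 2 := by
  have h := thetaChar_zero_mul_zero 0 (1 / 2) hτ
  rw [zero_add, zero_sub, thetaChar_zero_neg, thetaChar_one_one_half] at h
  linear_combination h

theorem thetaChar_one_zero_sq {τ : ℂ} (hτ : 0 < τ.im) :
    thetaChar 1 0 0 τ ^ 2 = 2 * thetaChar 0 0 0 (2 * τ) * thetaChar 1 0 0 (2 * τ) := by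
  have h := thetaChar_one_mul_one 0 0 hτ
  rw [zero_add, sub_zero] at h
  linear_combination h

theorem thetaChar_one_one_fourth_sq {τ : ℂ} (hτ : 0 < τ.im) :
    thetaChar 1 0 (1 / 4) τ ^ 2 = thetaChar 0 0 (1 / 2) (2 * τ) * thetaChar 1 0 0 (2 * τ) := by
  have h := thetaChar_one_mul_one (1 / 4) (1 / 4) hτ
  rw [sub_self, show (1 / 4 : ℂ) + 1 / 4 = 1 / 2 by norm_num, thetaChar_one_one_half] at h
  linear_combination h

theorem thetaChar_one_zero_mul_one_fourth {τ : ℂ} (hτ : 0 < τ.im) :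
    thetaChar 1 0 0 τ * thetaChar 1 0 (1 / 4) τ =
      2 * thetaChar 0 0 (1 / 4) (2 * τ) * thetaChar 1 0 (1 / 4) (2 * τ) := by
  have h := thetaChar_one_mul_one 0 (1 / 4) hτ
  rw [zero_add, zero_sub, thetaChar_zero_neg, thetaChar_one_neg] at h
  linear_combination h

theorem thetaCharDeriv_one_one_half_mul {τ : ℂ} (hτ : 0 < τ.im) :
    thetaCharDeriv 1 0 (1 / 2) τ * thetaChar 1 0 0 τ =
      2 * thetaCharDeriv 1 0 (1 / 2) (2 * τ) * thetaChar 0 0 (1 / 2) (2 * τ) := by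
  have h := thetaCharDeriv_one_mul_add (1 / 2) 0 hτ
  rw [add_zero, sub_zero, thetaChar_one_one_half, thetaChar_one_one_half] at h
  linear_combination h

theorem thetaCharDeriv_one_one_fourth_mul {τ : ℂ} (hτ : 0 < τ.im) :
    thetaCharDeriv 1 0 (1 / 4) τ * thetaChar 1 0 (1 / 4) τ =
      thetaCharDeriv 1 0 (1 / 2) (2 * τ) * thetaChar 0 0 0 (2 * τ) := by
  have h := thetaCharDeriv_one_mul_add (1 / 4) (1 / 4) hτ
  rw [sub_self, show (1 / 4 : ℂ) + 1 / 4 = 1 / 2 by norm_num, thetaCharDeriv_zero_one_half] at h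
  linear_combination h / 2

/-- A zero at τ forces zeros at all 2^k τ, against the limit 1. -/
theorem thetaChar_zero_one_half_ne_zero {τ : ℂ} (hτ : 0 < τ.im) :
    thetaChar 0 0 (1 / 2) τ ≠ 0 := by
  intro h
  have hk := forall_two_pow_mul (P := fun σ => thetaChar 0 0 (1 / 2) σ = 0) (fun σ hσ h0 => by
    have := thetaChar_zero_mul_one_half hσ
    rw [h0, mul_zero] at this
    exact pow_eq_zero_iff two_ne_zero |>.mp this.symm) hτ h
  have hl := tendsto_thetaChar_zero (1 / 2) hτ
  simp only [hk] at hl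
  exact zero_ne_one (tendsto_nhds_unique tendsto_const_nhds hl)

theorem thetaChar_zero_zero_ne_zero {τ : ℂ} (hτ : 0 < τ.im) : thetaChar 0 0 0 τ ≠ 0 := by
  intro h
  have := thetaChar_zero_mul_one_half hτ
  rw [h, zero_mul] at this
  exact pow_ne_zero 2 (thetaChar_zero_one_half_ne_zero (two_mul_im_pos hτ)) this.symm

theorem thetaChar_one_zero_ne_zero {τ : ℂ} (hτ : 0 < τ.im) : thetaChar 1 0 0 τ ≠ 0 := by
  intro h
  have hk := forall_two_pow_mul (P := fun σ => thetaChar 1 0 0 σ = 0) (fun σ hσ h0 => by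
    have h1 := thetaChar_one_zero_sq hσ
    have h2 := thetaChar_zero_zero_ne_zero (two_mul_im_pos hσ)
    simpa [h0, h2] using h1) hτ h
  have hl := tendsto_thetaChar_one 0 hτ
  simp only [hk, mul_zero, Complex.cos_zero, mul_one] at hl
  exact two_ne_zero (tendsto_nhds_unique tendsto_const_nhds hl).symm

theorem thetaChar_one_one_fourth_ne_zero {τ : ℂ} (hτ : 0 < τ.im) :
    thetaChar 1 0 (1 / 4) τ ≠ 0 := by
  intro h
  have h1 := thetaChar_one_one_fourth_sq hτ
  rw [h, zero_pow two_ne_zero] at h1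
  exact mul_ne_zero (thetaChar_zero_one_half_ne_zero (two_mul_im_pos hτ))
    (thetaChar_one_zero_ne_zero (two_mul_im_pos hτ)) h1.symm

/-! ### Identities from invariance under doubling -/

/-- Jacobi's derivative formula. -/
theorem thetaCharDeriv_one_one_half {τ : ℂ} (hτ : 0 < τ.im) :
    thetaCharDeriv 1 0 (1 / 2) τ =
      -(Real.pi * (thetaChar 1 0 0 τ * thetaChar 0 0 0 τ * thetaChar 0 0 (1 / 2) τ)) := by
  have h := eq_of_tendsto_two_pow_mul (L := -(2 * Real.pi * Complex.sin (Real.pi * (1 / 2))) /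
      (2 * Complex.cos (Real.pi * 0) * 1 * 1)) (f := fun σ => thetaCharDeriv 1 0 (1 / 2) σ /
      (thetaChar 1 0 0 σ * thetaChar 0 0 0 σ * thetaChar 0 0 (1 / 2) σ)) (fun σ hσ => by
    have hσ2 := two_mul_im_pos hσ
    rw [div_eq_div_iff
      (mul_ne_zero (mul_ne_zero (thetaChar_one_zero_ne_zero hσ2) (thetaChar_zero_zero_ne_zero hσ2))
        (thetaChar_zero_one_half_ne_zero hσ2))
      (mul_ne_zero (mul_ne_zero (thetaChar_one_zero_ne_zero hσ) (thetaChar_zero_zero_ne_zero hσ))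
        (thetaChar_zero_one_half_ne_zero hσ))]
    -- Duplication expresses θ₁(0)² and θ₁'(1/2)θ₁(0), not the single factors, hence the extra
    -- θ₁(0).
    apply mul_left_cancel₀ (thetaChar_one_zero_ne_zero hσ)
    linear_combination
      thetaCharDeriv 1 0 (1 / 2) (2 * σ) * thetaChar 1 0 0 σ ^ 2 * thetaChar_zero_mul_one_half hσ +
      thetaCharDeriv 1 0 (1 / 2) (2 * σ) * thetaChar 0 0 (1 / 2) (2 * σ) ^ 2 *
        thetaChar_one_zero_sq hσ -
      thetaChar 1 0 0 (2 * σ) * thetaChar 0 0 0 (2 * σ) * thetaChar 0 0 (1 / 2) (2 * σ) *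
        thetaCharDeriv_one_one_half_mul hσ) hτ (by
    refine ((tendsto_thetaCharDeriv_one (1 / 2) hτ).div
      (((tendsto_thetaChar_one 0 hτ).mul (tendsto_thetaChar_zero 0 hτ)).mul
        (tendsto_thetaChar_zero (1 / 2) hτ)) (by simp)).congr fun k => ?_
    simp only [Pi.div_apply, mul_assoc]
    exact mul_div_mul_left _ _ (Complex.exp_ne_zero _))
  rw [div_eq_iff (mul_ne_zero (mul_ne_zero (thetaChar_one_zero_ne_zero hτ)
    (thetaChar_zero_zero_ne_zero hτ)) (thetaChar_zero_one_half_ne_zero hτ))] at h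
  rw [h, show (Real.pi : ℂ) * (1 / 2) = Real.pi / 2 by ring, Complex.sin_pi_div_two, mul_zero,
    Complex.cos_zero]
  ring

theorem two_mul_cos_pi_div_four : 2 * Complex.cos (Real.pi * (1 / 4)) = (Real.sqrt 2 : ℝ) := by
  have h := congrArg (fun x : ℝ => (x : ℂ)) Real.cos_pi_div_four
  push_cast at h
  rw [show (Real.pi : ℂ) * (1 / 4) = Real.pi / 4 by ring, h]
  ring

theorem sqrt_two_ne_zero_complex : ((Real.sqrt 2 : ℝ) : ℂ) ≠ 0 := by
  simp

/-- The quotient of the two products is invariant under doubling, with limit 2 / (2 cos(π/4)) = √2.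
-/
theorem thetaChar_one_zero_mul_zero_one_fourth {τ : ℂ} (hτ : 0 < τ.im) :
    thetaChar 1 0 0 τ * thetaChar 0 0 (1 / 4) τ =
      (Real.sqrt 2 : ℝ) * (thetaChar 1 0 (1 / 4) τ * thetaChar 0 0 0 (2 * τ)) := by
  have hden {σ : ℂ} (hσ : 0 < σ.im) :
      thetaChar 1 0 (1 / 4) σ * thetaChar 0 0 0 (2 * σ) ≠ 0 :=
    mul_ne_zero (thetaChar_one_one_fourth_ne_zero hσ)
      (thetaChar_zero_zero_ne_zero (two_mul_im_pos hσ))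
  have h := eq_of_tendsto_two_pow_mul (L := 2 * Complex.cos (Real.pi * 0) * 1 /
      (2 * Complex.cos (Real.pi * (1 / 4)) * 1))
      (f := fun σ => thetaChar 1 0 0 σ * thetaChar 0 0 (1 / 4) σ /
      (thetaChar 1 0 (1 / 4) σ * thetaChar 0 0 0 (2 * σ))) (fun σ hσ => by
    have hσ2 := two_mul_im_pos hσ
    rw [div_eq_div_iff (hden hσ2) (hden hσ)]
    apply mul_left_cancel₀ (thetaChar_one_zero_ne_zero hσ)
    -- Rewritten at 1/4, this reads θ₀(0, 4σ) θ₀(1/4, σ) = θ₀(1/4, 2σ)².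
    have e1 := thetaChar_zero_mul_one_half (two_mul_im_pos hσ2)
    rw [← thetaChar_zero_one_fourth hσ, ← thetaChar_zero_one_fourth hσ2] at e1
    linear_combination
      thetaChar 1 0 0 (2 * σ) * thetaChar 0 0 (1 / 4) (2 * σ) * thetaChar 0 0 0 (2 * σ) *
        thetaChar_one_zero_mul_one_fourth hσ -
      thetaChar 0 0 (1 / 4) σ * thetaChar 1 0 (1 / 4) (2 * σ) * thetaChar 0 0 0 (2 * (2 * σ)) *
        thetaChar_one_zero_sq hσ -
      2 * thetaChar 1 0 0 (2 * σ) * thetaChar 0 0 0 (2 * σ) * thetaChar 1 0 (1 / 4) (2 * σ) * e1)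
    hτ (by
    have hp : Tendsto (fun k : ℕ => thetaChar 0 0 0 (2 * (2 ^ k * τ))) atTop (𝓝 1) := by
      refine (tendsto_thetaChar_zero 0 (two_mul_im_pos hτ)).congr fun k => ?_
      rw [mul_left_comm]
    refine (((tendsto_thetaChar_one 0 hτ).mul (tendsto_thetaChar_zero (1 / 4) hτ)).div
      ((tendsto_thetaChar_one (1 / 4) hτ).mul hp)
      (by simp only [two_mul_cos_pi_div_four, mul_one]; exact sqrt_two_ne_zero_complex)).congr
      fun k => ?_
    simp only [Pi.div_apply, mul_assoc]
    exact mul_div_mul_left _ _ (Complex.exp_ne_zero _))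
  rw [div_eq_iff (hden hτ), two_mul_cos_pi_div_four, mul_zero, Complex.cos_zero] at h
  rw [h]
  congr 1
  rw [mul_one, mul_one, mul_one, div_eq_iff sqrt_two_ne_zero_complex]
  norm_cast
  exact (Real.mul_self_sqrt zero_le_two).symm

/-! ### The points 1/8 and 3/8 -/

theorem thetaChar_one_one_eighth_mul {τ : ℂ} (hτ : 0 < τ.im) :
    thetaChar 1 0 (1 / 8) τ * thetaChar 1 0 (3 / 8) τ =
      thetaChar 0 0 (1 / 2) (2 * τ) * thetaChar 1 0 (1 / 4) (2 * τ) := by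
  have h := thetaChar_one_mul_one (1 / 8) (3 / 8) hτ
  rw [show (1 / 8 : ℂ) + 3 / 8 = 1 / 2 by norm_num, show (1 / 8 : ℂ) - 3 / 8 = -(1 / 4) by norm_num,
    thetaChar_one_one_half, thetaChar_one_neg] at h
  linear_combination h

/-- Taking v = -3/8 turns the sum into a difference, as θ₁' is odd, and makes u - v = 1/2 a zero of
θ₁. -/
theorem thetaCharDeriv_one_eighth_sub {τ : ℂ} (hτ : 0 < τ.im) :
    thetaCharDeriv 1 0 (1 / 8) τ * thetaChar 1 0 (3 / 8) τ -
        thetaChar 1 0 (1 / 8) τ * thetaCharDeriv 1 0 (3 / 8) τ =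
      -2 * thetaCharDeriv 1 0 (1 / 4) (2 * τ) * thetaChar 0 0 (1 / 2) (2 * τ) := by
  have h := thetaCharDeriv_one_mul_add (1 / 8) (-(3 / 8)) hτ
  rw [show (1 / 8 : ℂ) + -(3 / 8) = -(1 / 4) by norm_num,
    show (1 / 8 : ℂ) - -(3 / 8) = 1 / 2 by norm_num, thetaChar_one_one_half, thetaChar_one_neg,
    thetaCharDeriv_one_neg, thetaCharDeriv_one_neg] at h
  linear_combination h

theorem thetaCharDeriv_one_eighth_add {τ : ℂ} (hτ : 0 < τ.im) :
    thetaCharDeriv 1 0 (1 / 8) τ * thetaChar 1 0 (3 / 8) τ +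
        thetaChar 1 0 (1 / 8) τ * thetaCharDeriv 1 0 (3 / 8) τ =
      2 * thetaCharDeriv 1 0 (1 / 2) (2 * τ) * thetaChar 0 0 (1 / 4) (2 * τ) := by
  have h := thetaCharDeriv_one_mul_add (1 / 8) (3 / 8) hτ
  rw [show (1 / 8 : ℂ) + 3 / 8 = 1 / 2 by norm_num, show (1 / 8 : ℂ) - 3 / 8 = -(1 / 4) by norm_num,
    thetaCharDeriv_zero_one_half, thetaChar_zero_neg] at h
  linear_combination h

/-- Jacobi's formula at 2τ evaluates the logarithmic derivative at 1/4, which the difference formula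
needs. -/
theorem thetaCharDeriv_one_one_fourth {τ : ℂ} (hτ : 0 < τ.im) :
    thetaCharDeriv 1 0 (1 / 4) τ =
      -(Real.pi * thetaChar 0 0 0 (2 * τ) ^ 2 * thetaChar 1 0 (1 / 4) τ) := by
  apply mul_right_cancel₀ (thetaChar_one_one_fourth_ne_zero hτ)
  rw [thetaCharDeriv_one_one_fourth_mul hτ, thetaCharDeriv_one_one_half (two_mul_im_pos hτ)]
  linear_combination Real.pi * thetaChar 0 0 0 (2 * τ) ^ 2 * thetaChar_one_one_fourth_sq hτ

theorem mainTheorem3 (τ : UpperHalfPlane) :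
    thetaChar 1 (1 / 4) 0 (τ : ℂ) ≠ 0 ∧
    thetaChar 1 (3 / 4) 0 (τ : ℂ) ≠ 0 ∧
    thetaCharDeriv 1 (1 / 4) 0 (τ : ℂ) / thetaChar 1 (1 / 4) 0 (τ : ℂ) -
        thetaCharDeriv 1 (3 / 4) 0 (τ : ℂ) / thetaChar 1 (3 / 4) 0 (τ : ℂ) =
      2 * (Real.pi : ℂ) * thetaChar 0 0 0 (4 * (τ : ℂ)) ^ 2 ∧
    thetaCharDeriv 1 (1 / 4) 0 (τ : ℂ) / thetaChar 1 (1 / 4) 0 (τ : ℂ) +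
        thetaCharDeriv 1 (3 / 4) 0 (τ : ℂ) / thetaChar 1 (3 / 4) 0 (τ : ℂ) =
      -2 * ((Real.sqrt 2 : ℝ) : ℂ) * (Real.pi : ℂ) *
        thetaChar 0 0 0 (2 * (τ : ℂ)) * thetaChar 0 0 0 (4 * (τ : ℂ)) := by
  have hτ : 0 < (τ : ℂ).im := τ.im_pos
  generalize (τ : ℂ) = σ at hτ ⊢
  have hσ2 := two_mul_im_pos hτ
  have e1 : (0 : ℂ) + ((1 / 4 : ℝ) : ℂ) / 2 = 1 / 8 := by push_cast; norm_num
  have e3 : (0 : ℂ) + ((3 / 4 : ℝ) : ℂ) / 2 = 3 / 8 := by push_cast; norm_num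
  rw [thetaChar_snd_eq 1 (1 / 4), thetaChar_snd_eq 1 (3 / 4), thetaCharDeriv_snd_eq 1 (1 / 4),
    thetaCharDeriv_snd_eq 1 (3 / 4), e1, e3, show 4 * σ = 2 * (2 * σ) by ring]
  have hm := thetaChar_one_one_eighth_mul hτ
  have hne : thetaChar 1 0 (1 / 8) σ * thetaChar 1 0 (3 / 8) σ ≠ 0 := by
    rw [hm]
    exact mul_ne_zero (thetaChar_zero_one_half_ne_zero hσ2) (thetaChar_one_one_fourth_ne_zero hσ2)
  have h1 := left_ne_zero_of_mul hne
  have h3 := right_ne_zero_of_mul hne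
  refine ⟨h1, h3, ?_, ?_⟩
  · rw [div_sub_div _ _ h1 h3, div_eq_iff hne, thetaCharDeriv_one_eighth_sub hτ, hm,
      thetaCharDeriv_one_one_fourth hσ2]
    ring
  · rw [div_add_div _ _ h1 h3, div_eq_iff hne, thetaCharDeriv_one_eighth_add hτ, hm,
      thetaCharDeriv_one_one_half hσ2]
    linear_combination -2 * Real.pi * thetaChar 0 0 0 (2 * σ) * thetaChar 0 0 (1 / 2) (2 * σ) *
      thetaChar_one_zero_mul_zero_one_fourth hσ2
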